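/- Let $d\in\mathbb N$ and let $\|\cdot\|$ be the Euclidean norm on $\mathbb R^d$. Let $f:\mathbb R^d\to\mathbb R$ be differentiable, and suppose that for some constant $L\ge 0$ we have $\|\nabla f(x)-\nabla f(y)\|\le L\|x-y\|$ for all $x,y\in\mathbb R^d$. Suppose that there are $x_0\in\mathbb R^d$ and constants $\mu,\beta>0$ with $\langle\nabla f(x),x-x_0\rangle\ge\frac{\mu}{2}\|x-x_0\|^2-\beta$ for all $x\in\mathbb R^d$. Let $g:\mathbb R^d\to\mathbb R$ be convex with $|g(x)-g(y)|\le M_d\|x-y\|$ for all $x,y\in\mathbb R^d$, where $M_d>0$. Put $U=f+g$ and let $\eta\in\left(0,\frac{1}{16(L+1)}\right)$. Define $$Z(u)=\int_{\mathbb R^d}\exp\left(-\frac{1}{4\eta}\|y-u\|^2-g(y)\right)dy,$$ $$p(x,y)=\frac{1}{Z(x-\eta\nabla f(x))}\exp\left(-\frac{1}{4\eta}\|y-(x-\eta\nabla f(x))\|^2-g(y)\right),$$ $$\alpha(x,y)=\min\left(1,\frac{e^{-U(y)}\,p(y,x)}{e^{-U(x)}\,p(x,y)}\right),$$ and let $\mathcal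 T^{succ}_x$ be the one-step transition law from $x$ of the Metropolis--Hastings chain with proposal density $p(x,\cdot)$ and acceptance probability $\alpha$, conditioned on acceptance of the proposal: $$\mathcal T^{succ}_x(A)=\frac{\int_A p(x,y)\,\alpha(x,y)\,dy}{\int_{\mathbb R^d}p(x,y)\,\alpha(x,y)\,dy}.$$ Let $d_{TV}(P,Q)=\sup_A|P(A)-Q(A)|$, where the supremum is over Borel sets $A\subseteq\mathbb R^d$. Then, for any $x_1,x_2\in\mathbb R^d$, $\mathcal T^{succ}_{x_1}$ and $\mathcal T^{succ}_{x_2}$ are well-defined probability measures and $$d_{TV}\left(\mathcal T^{succ}_{x_1},\mathcal T^{succ}_{x_2}\right)\le 5\sqrt{\|x_1-x_2\|\left(\|\nabla f(x_1)\|+\|\nabla f(x_2)\|+M_d+L\sqrt{\eta d}\right)}+2\,\frac{\|x_1-x_2\|}{\sqrt\eta}.$$ -/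

import Mathlib

open MeasureTheory

noncomputable section

/-- Total variation distance: the supremum of `|P A - Q A|` over all measurable sets `A`. -/
def tvDist {E : Type*} [MeasurableSpace E] (P Q : Measure E) : ℝ :=
  ⨆ A : {A : Set E // MeasurableSet A}, |P.real A.1 - Q.real A.1|

/-- Partition function of the proximal sampling oracle with stepsize `η`:
`Z(u) = ∫ exp (-‖y - u‖² / (4η) - g y) dy`. -/
def oracleZ {d : ℕ} (g : EuclideanSpace ℝ (Fin d) → ℝ) (η : ℝ)
    (u : EuclideanSpace ℝ (Fin d)) : ℝ :=
  ∫ y, Real.exp (-(1 / (4 * η)) * ‖y - u‖ ^ 2 - g y)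

/-- Proposal density `p(x, y)`: the oracle queried at the gradient step `x - η ∇f(x)`. -/
def proposalDensity {d : ℕ} (f g : EuclideanSpace ℝ (Fin d) → ℝ) (η : ℝ)
    (x y : EuclideanSpace ℝ (Fin d)) : ℝ :=
  (oracleZ g η (x - η • gradient f x))⁻¹ *
    Real.exp (-(1 / (4 * η)) * ‖y - (x - η • gradient f x)‖ ^ 2 - g y)

/-- Probability of accepting the move from `x` to `y` (Metropolis--Hastings rule for the target
density proportional to `exp (-U)`, where `U = f + g`). -/
def acceptProb {d : ℕ} (f g : EuclideanSpace ℝ (Fin d) → ℝ) (η : ℝ)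
    (x y : EuclideanSpace ℝ (Fin d)) : ℝ :=
  min 1 ((Real.exp (-(f y + g y)) * proposalDensity f g η y x) /
    (Real.exp (-(f x + g x)) * proposalDensity f g η x y))

/-- The accepted part of the transition kernel at `x`: its mass on `A` is the probability that
the proposal lands in `A` and is accepted. -/
def acceptedMeasure {d : ℕ} (f g : EuclideanSpace ℝ (Fin d) → ℝ) (η : ℝ)
    (x : EuclideanSpace ℝ (Fin d)) : Measure (EuclideanSpace ℝ (Fin d)) :=
  volume.withDensity fun y =>
    ENNReal.ofReal (proposalDensity f g η x y * acceptProb f g η x y)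

/-- The transition kernel at `x` conditioned on the proposal being accepted. -/
def succKernel {d : ℕ} (f g : EuclideanSpace ℝ (Fin d) → ℝ) (η : ℝ)
    (x : EuclideanSpace ℝ (Fin d)) : Measure (EuclideanSpace ℝ (Fin d)) :=
  (acceptedMeasure f g η x Set.univ)⁻¹ • acceptedMeasure f g η x

end

/-! Write the acceptance probability as `min 1 (exp H)`, with `H = logRatio`. The law from `x` given
acceptance is then the Gibbs measure of `W_x = succPotential f g η x`, because the oracle normaliser
`Z` at `x` is constant in `y` and cancels. Total variation is bounded through the symmetrised
relative entropy of the two Gibbs measures. In that sum the unknown normalisers cancel, so it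
suffices to bound the mean of `W_{x₂} - W_{x₁}` under the law at `x₁`, and the same with the roles
exchanged.

The dangerous part of this difference is linear in `y`, with slope of order `‖x₁ - x₂‖ / η`;
estimating it by the size of `y` would cost a factor `√(d / η)`. Instead, translate by the
displacement `w` of the gradient steps. Translation invariance and `exp t ≥ 1 + t` show that
`W_{x₁}(y + w) - W_{x₁}(y)` has nonnegative mean, so it may be added for free. Its linear part is
exactly opposite, and only `‖w‖² / (2η)` survives from the Gaussian terms
(`succPotential_increment_le`).

What remains consists of increments of `g` and `H`. Those of `H` are controlled by a trapezoid
estimate for `f` and the Lipschitz continuity of `log Z`. They leave a term `L ‖x₁ - x₂‖ ‖y - x₁‖`,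
whose mean is bounded by comparing the Gibbs density with its image under a contraction towards
`x₁`, at entropic cost `d log 2` (`integral_norm_sub_mul_exp_neg_succPotential_le`). -/

/-! ### Quadratic growth conditions, used for integrability. -/

/-- `W` dominates a positive multiple of the squared norm, up to a constant. -/
def QuadraticallyCoercive {V : Type*} [NormedAddCommGroup V] (W : V → ℝ) : Prop :=
  ∃ a c : ℝ, 0 < a ∧ ∀ y, a * ‖y‖ ^ 2 - c ≤ W y

/-- `φ` grows at most quadratically. -/
def QuadraticallyBounded {V : Type*} [NormedAddCommGroup V] (φ : V → ℝ) : Prop :=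
  ∃ C : ℝ, ∀ y, |φ y| ≤ C * (1 + ‖y‖ ^ 2)

namespace QuadraticallyBounded

variable {V : Type*} [NormedAddCommGroup V] {φ ψ : V → ℝ}

theorem add (hφ : QuadraticallyBounded φ) (hψ : QuadraticallyBounded ψ) :
    QuadraticallyBounded fun y => φ y + ψ y := by
  obtain ⟨C, hC⟩ := hφ
  obtain ⟨D, hD⟩ := hψ
  refine ⟨C + D, fun y => (abs_add_le _ _).trans ?_⟩
  linarith [hC y, hD y]

theorem mono (hψ : QuadraticallyBounded ψ) (h : ∀ y, |φ y| ≤ |ψ y|) :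
    QuadraticallyBounded φ := by
  obtain ⟨C, hC⟩ := hψ
  exact ⟨C, fun y => (h y).trans (hC y)⟩

theorem neg (hφ : QuadraticallyBounded φ) : QuadraticallyBounded fun y => -φ y :=
  hφ.mono fun y => by rw [abs_neg]

theorem sub (hφ : QuadraticallyBounded φ) (hψ : QuadraticallyBounded ψ) :
    QuadraticallyBounded fun y => φ y - ψ y := by
  simpa only [sub_eq_add_neg] using hφ.add hψ.neg

theorem const_mul (hφ : QuadraticallyBounded φ) (c : ℝ) :
    QuadraticallyBounded fun y => c * φ y := by
  obtain ⟨C, hC⟩ := hφ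
  refine ⟨|c| * C, fun y => ?_⟩
  rw [abs_mul, mul_assoc]
  exact mul_le_mul_of_nonneg_left (hC y) (abs_nonneg c)

theorem const (c : ℝ) : QuadraticallyBounded fun _ : V => c :=
  ⟨|c|, fun y => le_mul_of_one_le_right (abs_nonneg c) (by nlinarith [sq_nonneg ‖y‖])⟩

theorem norm_sub_sq (x : V) : QuadraticallyBounded fun y => ‖y - x‖ ^ 2 := by
  refine ⟨2 * (1 + ‖x‖ ^ 2), fun y => ?_⟩
  rw [abs_of_nonneg (sq_nonneg _)]
  have h1 := norm_sub_le y x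
  have h2 := norm_nonneg (y - x)
  nlinarith [sq_nonneg (‖y‖ - ‖x‖), mul_nonneg (sq_nonneg ‖y‖) (sq_nonneg ‖x‖)]

theorem norm_sub (x : V) : QuadraticallyBounded fun y => ‖y - x‖ := by
  refine ((const 1).add (norm_sub_sq x)).mono fun y => ?_
  have h := norm_nonneg (y - x)
  rw [abs_of_nonneg h, abs_of_nonneg (by positivity)]
  nlinarith [sq_nonneg (‖y - x‖ - 1)]

theorem exists_poly {a b c : ℝ} {x : V} (h : ∀ y, |φ y| ≤ a + b * ‖y - x‖ + c * ‖y - x‖ ^ 2) :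
    QuadraticallyBounded φ :=
  (((const a).add ((norm_sub x).const_mul b)).add ((norm_sub_sq x).const_mul c)).mono
    fun y => (h y).trans (le_abs_self _)

end QuadraticallyBounded

/-! ### Integrals against `exp (-W)`, and total variation from relative entropy. -/

section GibbsDensity

variable {V : Type*} [NormedAddCommGroup V] [InnerProductSpace ℝ V] [FiniteDimensional ℝ V]
  [MeasurableSpace V] [BorelSpace V]

theorem integrable_exp_neg_mul_norm_sq {b : ℝ} (hb : 0 < b) :
    Integrable (fun y : V => Real.exp (-b * ‖y‖ ^ 2)) := by
  have h := (GaussianFourier.integrable_cexp_neg_mul_sq_norm_add (V := V) (b := (b : ℂ))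
    (by simpa using hb) 0 0).norm
  refine h.congr (Filter.Eventually.of_forall fun y => ?_)
  simp only [Complex.norm_exp]
  congr 1
  simp [← Complex.ofReal_pow, ← Complex.ofReal_neg, ← Complex.ofReal_mul]

theorem QuadraticallyBounded.integrable_mul_exp_neg {W φ : V → ℝ} (hφ : QuadraticallyBounded φ)
    (hφc : Continuous φ) (hW : QuadraticallyCoercive W) (hWc : Continuous W) :
    Integrable fun y => φ y * Real.exp (-W y) := by
  obtain ⟨C, hC⟩ := hφ
  obtain ⟨a, c, ha, hac⟩ := hW
  have hC0 : 0 ≤ C := by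
    have := (abs_nonneg _).trans (hC 0)
    simpa using this
  have hint := (integrable_exp_neg_mul_norm_sq (V := V) (half_pos ha)).const_mul
    (C * (1 + 2 / a) * Real.exp c)
  refine hint.mono' (hφc.mul (Real.continuous_exp.comp hWc.neg)).aestronglyMeasurable
    (Filter.Eventually.of_forall fun y => ?_)
  -- Half of the Gaussian decay absorbs the quadratic factor; the other half is integrated.
  have h1 : 1 + ‖y‖ ^ 2 ≤ (1 + 2 / a) * Real.exp (a / 2 * ‖y‖ ^ 2) := by
    have e1 := Real.add_one_le_exp (a / 2 * ‖y‖ ^ 2)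
    have e2 : 0 ≤ a / 2 * ‖y‖ ^ 2 := by positivity
    calc 1 + ‖y‖ ^ 2 = 1 + 2 / a * (a / 2 * ‖y‖ ^ 2) := by field_simp
      _ ≤ (1 + 2 / a) * (a / 2 * ‖y‖ ^ 2 + 1) := by
        have : 0 < 2 / a := by positivity
        nlinarith
      _ ≤ _ := by gcongr
  rw [norm_mul, Real.norm_eq_abs, Real.norm_eq_abs, abs_of_pos (Real.exp_pos _)]
  calc |φ y| * Real.exp (-W y)
      ≤ (C * ((1 + 2 / a) * Real.exp (a / 2 * ‖y‖ ^ 2))) * Real.exp (c - a * ‖y‖ ^ 2) := by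
        gcongr
        · exact (hC y).trans (mul_le_mul_of_nonneg_left h1 hC0)
        · linarith [hac y]
    _ = C * (1 + 2 / a) * Real.exp c * Real.exp (-(a / 2) * ‖y‖ ^ 2) := by
        rw [show c - a * ‖y‖ ^ 2 = c + (-(a / 2) * ‖y‖ ^ 2 + -(a / 2 * ‖y‖ ^ 2)) by ring,
          Real.exp_add, Real.exp_add, Real.exp_neg (a / 2 * ‖y‖ ^ 2)]
        have := (Real.exp_pos (a / 2 * ‖y‖ ^ 2)).ne'
        field_simp

theorem QuadraticallyCoercive.integrable_exp_neg {W : V → ℝ} (hW : QuadraticallyCoercive W)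
    (hWc : Continuous W) : Integrable fun y => Real.exp (-W y) := by
  simpa using (QuadraticallyBounded.const (V := V) 1).integrable_mul_exp_neg continuous_const hW hWc

/-- Translation invariance of Lebesgue measure: increments of `W` have nonnegative mean under
the density proportional to `exp (-W)`. -/
theorem integral_mul_exp_neg_nonneg_of_shift {W B : V → ℝ} (w : V)
    (hW : Integrable fun y => Real.exp (-W y)) (hB : Integrable fun y => B y * Real.exp (-W y))
    (h : ∀ y, W (y + w) - W y ≤ B y) : 0 ≤ ∫ y, B y * Real.exp (-W y) := by
  -- Integrate `1 - B ≤ exp (-B)` against `exp (-W)`; the translate on the right has the same total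
  -- mass.
  have h1 : ∫ y, (Real.exp (-W y) - B y * Real.exp (-W y)) ≤ ∫ y, Real.exp (-W (y + w)) := by
    refine integral_mono (hW.sub hB) (hW.comp_add_right w) fun y => ?_
    have e1 := Real.add_one_le_exp (-B y)
    have e2 : Real.exp (-B y) * Real.exp (-W y) ≤ Real.exp (-W (y + w)) := by
      rw [← Real.exp_add]
      exact Real.exp_le_exp.2 (by linarith [h y])
    nlinarith [Real.exp_pos (-W y)]
  rw [integral_sub hW hB, integral_add_right_eq_self (fun y => Real.exp (-W y)) w] at h1
  linarith

/-- Behaviour of Lebesgue measure under the contraction by `1/2` towards `x`. -/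
theorem integral_mul_exp_neg_le_of_contraction {W B : V → ℝ} (x : V)
    (hW : Integrable fun y => Real.exp (-W y)) (hB : Integrable fun y => B y * Real.exp (-W y))
    (h : ∀ y, B y ≤ W y - W (x + (2⁻¹ : ℝ) • (y - x))) :
    ∫ y, B y * Real.exp (-W y) ≤
      (Module.finrank ℝ V * Real.log 2) * ∫ y, Real.exp (-W y) := by
  set n := Module.finrank ℝ V with hn
  have hW' : Integrable fun y => Real.exp (-W (x + y)) := hW.comp_add_left x
  have hW2 : Integrable fun y => Real.exp (-W (x + (2⁻¹ : ℝ) • (y - x))) :=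
    (hW'.comp_smul (R := (2⁻¹ : ℝ)) (by norm_num)).comp_sub_right x
  have hI : ∫ y, Real.exp (-W (x + (2⁻¹ : ℝ) • (y - x))) = 2 ^ n * ∫ y, Real.exp (-W y) := by
    rw [integral_sub_right_eq_self (fun y => Real.exp (-W (x + (2⁻¹ : ℝ) • y))) x,
      Measure.integral_comp_smul volume (fun y => Real.exp (-W (x + y))),
      integral_add_left_eq_self (fun y => Real.exp (-W y)) x]
    rw [smul_eq_mul, ← hn, inv_pow, inv_inv, abs_of_pos (by positivity)]
  -- The factor `2⁻ⁿ` restores the mass of `exp (-W)` after the change of variables. Writing it as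
  -- `exp (-n log 2)` and applying `exp t ≥ 1 + t` at `t = B - n log 2` gives the cost `n log 2`.
  have h1 : ∫ y, (B y * Real.exp (-W y) + (1 - n * Real.log 2) * Real.exp (-W y)) ≤
      ∫ y, (2 ^ n : ℝ)⁻¹ * Real.exp (-W (x + (2⁻¹ : ℝ) • (y - x))) := by
    refine integral_mono (hB.add (hW.const_mul _)) (hW2.const_mul _) fun y => ?_
    have e1 := Real.add_one_le_exp (B y - n * Real.log 2)
    have e2 : Real.exp (B y - n * Real.log 2) * Real.exp (-W y) ≤
        (2 ^ n : ℝ)⁻¹ * Real.exp (-W (x + (2⁻¹ : ℝ) • (y - x))) := by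
      have e3 : (2 ^ n : ℝ)⁻¹ = Real.exp (-(n * Real.log 2)) := by
        rw [Real.exp_neg, Real.exp_nat_mul, Real.exp_log (by norm_num)]
      rw [e3, ← Real.exp_add, ← Real.exp_add]
      exact Real.exp_le_exp.2 (by linarith [h y])
    have := Real.exp_pos (-W y)
    simp only
    nlinarith
  rw [integral_add hB (hW.const_mul _), integral_const_mul, integral_const_mul, hI,
    inv_mul_cancel_left₀ (by positivity)] at h1
  linarith

/-- For `b ≤ a`, `log (a / b) ≥ 1 - b / a` gives `a - b ≤ a (log a - log b)`. -/
theorem sq_sub_le_add_mul_log_sub_log {p q : ℝ} (hp : 0 < p) (hq : 0 < q) :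
    (p - q) ^ 2 ≤ (p + q) * ((p - q) * (Real.log p - Real.log q)) := by
  have key : ∀ {a b : ℝ}, 0 < a → 0 < b → b ≤ a →
      (a - b) ^ 2 ≤ (a + b) * ((a - b) * (Real.log a - Real.log b)) := by
    intro a b ha hb hab
    have h1 : 1 - b / a ≤ Real.log a - Real.log b := by
      have := Real.log_le_sub_one_of_pos (div_pos hb ha)
      rw [Real.log_div hb.ne' ha.ne'] at this
      linarith
    have h2 : a - b ≤ (a + b) * (Real.log a - Real.log b) := by
      have h3 : a * (1 - b / a) = a - b := by field_simp
      have h4 : 0 ≤ 1 - b / a := by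
        rw [sub_nonneg]
        exact (div_le_one ha).2 hab
      nlinarith
    nlinarith
  rcases le_total q p with h | h
  · exact key hp hq h
  · have := key hq hp h
    nlinarith

/-- The preceding inequality followed by the weighted arithmetic-geometric mean inequality. The last
term is the integrand of the symmetrised relative entropy. -/
theorem abs_sub_le_of_log {p q s : ℝ} (hp : 0 < p) (hq : 0 < q) (hs : 0 < s) :
    |p - q| ≤ s / 2 * (p + q) + 1 / (2 * s) * ((p - q) * (Real.log p - Real.log q)) := by
  have h := sq_sub_le_add_mul_log_sub_log hp hq
  set J := (p - q) * (Real.log p - Real.log q)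
  have h1 : (s / 2 * (p + q) + 1 / (2 * s) * J) ^ 2 ≥ (p + q) * J := by
    have : (s / 2 * (p + q) + 1 / (2 * s) * J) ^ 2 =
        (s / 2 * (p + q) - 1 / (2 * s) * J) ^ 2 + (p + q) * J := by
      field_simp
      ring
    nlinarith [sq_nonneg (s / 2 * (p + q) - 1 / (2 * s) * J)]
  have hJ : 0 ≤ J := by
    have : 0 ≤ (p + q) * J := (sq_nonneg _).trans h
    exact nonneg_of_mul_nonneg_right this (by positivity)
  exact abs_le_of_sq_le_sq (h.trans h1) (by positivity)

/-- Total variation between two normalized densities `exp (-W₁)`, `exp (-W₂)` is controlled by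
the relative entropies in both directions. -/
theorem abs_setIntegral_div_sub_le {W₁ W₂ : V → ℝ} {K : ℝ} (hK : 0 < K)
    (h₁ : Integrable fun y => Real.exp (-W₁ y)) (h₂ : Integrable fun y => Real.exp (-W₂ y))
    (hD₁ : Integrable fun y => (W₂ y - W₁ y) * Real.exp (-W₁ y))
    (hD₂ : Integrable fun y => (W₁ y - W₂ y) * Real.exp (-W₂ y))
    (hK₁ : ∫ y, (W₂ y - W₁ y) * Real.exp (-W₁ y) ≤ K * ∫ y, Real.exp (-W₁ y))
    (hK₂ : ∫ y, (W₁ y - W₂ y) * Real.exp (-W₂ y) ≤ K * ∫ y, Real.exp (-W₂ y))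
    {A : Set V} (hA : MeasurableSet A) :
    |(∫ y, Real.exp (-W₁ y))⁻¹ * (∫ y in A, Real.exp (-W₁ y)) -
      (∫ y, Real.exp (-W₂ y))⁻¹ * ∫ y in A, Real.exp (-W₂ y)| ≤ √K := by
  set I₁ := ∫ y, Real.exp (-W₁ y) with hI₁
  set I₂ := ∫ y, Real.exp (-W₂ y) with hI₂
  have p₁ : 0 < I₁ := integral_exp_pos h₁
  have p₂ : 0 < I₂ := integral_exp_pos h₂
  set p : V → ℝ := fun y => I₁⁻¹ * Real.exp (-W₁ y) with hp
  set q : V → ℝ := fun y => I₂⁻¹ * Real.exp (-W₂ y) with hq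
  have ip : Integrable p := h₁.const_mul _
  have iq : Integrable q := h₂.const_mul _
  have ip1 : ∫ y, p y = 1 := by rw [hp, integral_const_mul, inv_mul_cancel₀ p₁.ne']
  have iq1 : ∫ y, q y = 1 := by rw [hq, integral_const_mul, inv_mul_cancel₀ p₂.ne']
  have hs : 0 < √K := Real.sqrt_pos.2 hK
  -- The normalisers enter only through a multiple of `p - q`, which integrates to zero.
  have hA' : ∀ y, (p y - q y) * (Real.log (p y) - Real.log (q y)) =
      I₁⁻¹ * ((W₂ y - W₁ y) * Real.exp (-W₁ y)) + I₂⁻¹ * ((W₁ y - W₂ y) * Real.exp (-W₂ y)) +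
        (Real.log I₂ - Real.log I₁) * (p y - q y) := by
    intro y
    simp only [hp, hq]
    rw [Real.log_mul (inv_ne_zero p₁.ne') (Real.exp_pos _).ne',
      Real.log_mul (inv_ne_zero p₂.ne') (Real.exp_pos _).ne', Real.log_inv, Real.log_inv,
      Real.log_exp, Real.log_exp]
    ring
  have iJ1 : Integrable fun y => I₁⁻¹ * ((W₂ y - W₁ y) * Real.exp (-W₁ y)) +
      I₂⁻¹ * ((W₁ y - W₂ y) * Real.exp (-W₂ y)) := (hD₁.const_mul I₁⁻¹).add (hD₂.const_mul I₂⁻¹)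
  have iJ2 : Integrable fun y => (Real.log I₂ - Real.log I₁) * (p y - q y) :=
    (ip.sub iq).const_mul (Real.log I₂ - Real.log I₁)
  have iS : Integrable fun y => √K / 2 * (p y + q y) := (ip.add iq).const_mul _
  have iJ : Integrable fun y => (p y - q y) * (Real.log (p y) - Real.log (q y)) :=
    (iJ1.add iJ2).congr (Filter.Eventually.of_forall fun y => (hA' y).symm)
  have hJ : ∫ y, (p y - q y) * (Real.log (p y) - Real.log (q y)) ≤ 2 * K := by
    rw [integral_congr_ae (Filter.Eventually.of_forall hA'), integral_add iJ1 iJ2,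
      integral_add (hD₁.const_mul _) (hD₂.const_mul _), integral_const_mul, integral_const_mul,
      integral_const_mul, integral_sub ip iq, ip1, iq1]
    have e1 : I₁⁻¹ * (∫ y, (W₂ y - W₁ y) * Real.exp (-W₁ y)) ≤ K := by
      rw [inv_mul_le_iff₀ p₁]
      linarith
    have e2 : I₂⁻¹ * (∫ y, (W₁ y - W₂ y) * Real.exp (-W₂ y)) ≤ K := by
      rw [inv_mul_le_iff₀ p₂]
      linarith
    linarith
  -- With weight `s`, integration gives `s + K / s`, minimised at `s = √K`.
  have hL1 : ∫ y, |p y - q y| ≤ 2 * √K := by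
    have e1 : ∫ y, |p y - q y| ≤ ∫ y, (√K / 2 * (p y + q y) +
        1 / (2 * √K) * ((p y - q y) * (Real.log (p y) - Real.log (q y)))) := by
      refine integral_mono (ip.sub iq).abs (iS.add (iJ.const_mul _))
        fun y => abs_sub_le_of_log ?_ ?_ hs
      · exact mul_pos (inv_pos.2 p₁) (Real.exp_pos _)
      · exact mul_pos (inv_pos.2 p₂) (Real.exp_pos _)
    rw [integral_add iS (iJ.const_mul _), integral_const_mul,
      integral_const_mul, integral_add ip iq, ip1, iq1] at e1
    have e2 : 1 / (2 * √K) * (∫ y, (p y - q y) * (Real.log (p y) - Real.log (q y))) ≤ √K := by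
      calc _ ≤ 1 / (2 * √K) * (2 * K) := by gcongr
        _ = √K := by
          field_simp
          rw [Real.sq_sqrt hK.le]
    linarith
  -- Since `p - q` has integral zero, `A` and its complement contribute equally in absolute value,
  -- so each carries at most half of the `L¹` norm.
  have hsplit := integral_add_compl hA (ip.sub iq)
  have hsplit' : (∫ y in A, |(p - q) y|) + ∫ y in Aᶜ, |(p - q) y| = ∫ y, |(p - q) y| :=
    integral_add_compl hA (ip.sub iq).abs
  have e0 : ∫ y, (p - q) y = 0 := by
    simp only [Pi.sub_apply]
    rw [integral_sub ip iq, ip1, iq1, sub_self]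
  have eA : I₁⁻¹ * (∫ y in A, Real.exp (-W₁ y)) - I₂⁻¹ * ∫ y in A, Real.exp (-W₂ y) =
      ∫ y in A, (p - q) y := by
    simp only [Pi.sub_apply]
    rw [integral_sub ip.integrableOn iq.integrableOn, hp, hq, integral_const_mul,
      integral_const_mul]
  have b1 : |∫ y in A, (p - q) y| ≤ ∫ y in A, |(p - q) y| := abs_integral_le_integral_abs
  have b2 : |∫ y in Aᶜ, (p - q) y| ≤ ∫ y in Aᶜ, |(p - q) y| := abs_integral_le_integral_abs
  have b3 : ∫ y, |(p - q) y| ≤ 2 * √K := hL1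
  have b4 : |∫ y in Aᶜ, (p - q) y| = |∫ y in A, (p - q) y| := by
    rw [← abs_neg]
    congr 1
    linarith
  rw [eA]
  linarith

end GibbsDensity

/-! ### Trapezoid rule for smooth functions. -/

/-- Mean value inequality for `f` minus the linear map given by the averaged end gradients. For `z`
on the segment, `‖z - x‖ + ‖z - y‖ = ‖y - x‖`, which yields the constant `L / 2`. -/
theorem abs_sub_sub_inner_trapezoid_le {V : Type*} [NormedAddCommGroup V] [InnerProductSpace ℝ V]
    [CompleteSpace V] {f : V → ℝ} {L : ℝ} (hf : Differentiable ℝ f)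
    (hsmooth : ∀ x y, ‖gradient f x - gradient f y‖ ≤ L * ‖x - y‖) (x y : V) :
    |f y - f x - (1 / 2) * inner ℝ (y - x) (gradient f x + gradient f y)| ≤
      L / 2 * ‖y - x‖ ^ 2 := by
  have h := (convex_segment (𝕜 := ℝ) x y).norm_image_sub_le_of_norm_hasFDerivWithin_le'
    (f := f) (f' := fun z => InnerProductSpace.toDual ℝ V (gradient f z))
    (φ := InnerProductSpace.toDual ℝ V ((1 / 2 : ℝ) • (gradient f x + gradient f y)))
    (C := L / 2 * ‖y - x‖) (x := x) (y := y)
    (fun z _ => ((hf z).hasGradientAt.hasFDerivAt).hasFDerivWithinAt) ?_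
    (left_mem_segment ℝ x y) (right_mem_segment ℝ x y)
  · rw [InnerProductSpace.toDual_apply_apply, Real.norm_eq_abs, real_inner_smul_left,
      real_inner_comm] at h
    linarith
  · intro z hz
    rw [← map_sub, LinearIsometryEquiv.norm_map]
    have hxy : ‖z - x‖ + ‖z - y‖ = ‖y - x‖ := by
      have := dist_add_dist_of_mem_segment hz
      rwa [dist_comm x z, dist_eq_norm, dist_eq_norm, dist_comm x y, dist_eq_norm] at this
    calc ‖gradient f z - (1 / 2 : ℝ) • (gradient f x + gradient f y)‖
        = ‖(1 / 2 : ℝ) • ((gradient f z - gradient f x) + (gradient f z - gradient f y))‖ := by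
          congr 1
          module
      _ ≤ 1 / 2 * (‖gradient f z - gradient f x‖ + ‖gradient f z - gradient f y‖) := by
          rw [norm_smul, Real.norm_of_nonneg (by norm_num)]
          gcongr
          exact norm_add_le _ _
      _ ≤ 1 / 2 * (L * ‖z - x‖ + L * ‖z - y‖) := by gcongr <;> apply hsmooth
      _ = L / 2 * ‖y - x‖ := by rw [← hxy]; ring

theorem abs_norm_sq_sub_norm_sq_le {V : Type*} [SeminormedAddCommGroup V] (a b : V) :
    |‖a‖ ^ 2 - ‖b‖ ^ 2| ≤ ‖a - b‖ * (‖a‖ + ‖b‖) := by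
  rw [sq_sub_sq, mul_comm, abs_mul, abs_of_nonneg (add_nonneg (norm_nonneg a) (norm_nonneg b))]
  exact mul_le_mul_of_nonneg_right (abs_norm_sub_norm_le a b) (by positivity)

/-! ### Potentials of the proposal and of the conditioned kernel. -/

noncomputable section ConditionedKernel

variable {d : ℕ}

local notation "𝔼" => EuclideanSpace ℝ (Fin d)

/-- The gradient step from `x`. -/
def gradStep (f : EuclideanSpace ℝ (Fin d) → ℝ) (η : ℝ) (x : EuclideanSpace ℝ (Fin d)) :
    EuclideanSpace ℝ (Fin d) :=
  x - η • gradient f x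

/-- Logarithm of the Metropolis--Hastings ratio. -/
def logRatio (f g : EuclideanSpace ℝ (Fin d) → ℝ) (η : ℝ) (x y : EuclideanSpace ℝ (Fin d)) : ℝ :=
  f x - f y - (1 / 2) * inner ℝ (x - y) (gradient f x + gradient f y) -
    η / 4 * (‖gradient f y‖ ^ 2 - ‖gradient f x‖ ^ 2) +
    (Real.log (oracleZ g η (gradStep f η x)) - Real.log (oracleZ g η (gradStep f η y)))

/-- Up to an additive constant, minus the logarithm of the density of accepted moves from `x`. -/
def succPotential (f g : EuclideanSpace ℝ (Fin d) → ℝ) (η : ℝ)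
    (x y : EuclideanSpace ℝ (Fin d)) : ℝ :=
  1 / (4 * η) * ‖y - gradStep f η x‖ ^ 2 + g y + max 0 (-logRatio f g η x y)

/-- The potential of the proposal centred at `u`. -/
def oraclePotential (g : EuclideanSpace ℝ (Fin d) → ℝ) (η : ℝ) (u y : EuclideanSpace ℝ (Fin d)) :
    ℝ :=
  1 / (4 * η) * ‖y - u‖ ^ 2 + g y

section Oracle

variable {g : EuclideanSpace ℝ (Fin d) → ℝ} {M η : ℝ}

theorem continuous_of_abs_sub_le (hglip : ∀ x y, |g x - g y| ≤ M * ‖x - y‖) : Continuous g := by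
  have hM : ∀ x y, |g x - g y| ≤ |M| * ‖x - y‖ := fun x y =>
    (hglip x y).trans (mul_le_mul_of_nonneg_right (le_abs_self M) (norm_nonneg _))
  exact (LipschitzWith.of_dist_le' (K := |M|) fun x y => by
    rw [Real.dist_eq, dist_eq_norm]
    exact hM x y).continuous

theorem continuous_oraclePotential (hglip : ∀ x y, |g x - g y| ≤ M * ‖x - y‖) (u : 𝔼) :
    Continuous (oraclePotential g η u) := by
  have := continuous_of_abs_sub_le hglip
  unfold oraclePotential
  fun_prop

theorem quadraticallyCoercive_oraclePotential (hη : 0 < η)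
    (hglip : ∀ x y, |g x - g y| ≤ M * ‖x - y‖) (u : 𝔼) :
    QuadraticallyCoercive (oraclePotential g η u) := by
  set a := 1 / (4 * η) with ha
  have ha0 : 0 < a := by positivity
  refine ⟨a / 4, a * ‖u‖ ^ 2 + M ^ 2 / a - g 0, by positivity, fun y => ?_⟩
  have h1 := (abs_le.1 (hglip y 0)).1
  rw [sub_zero] at h1
  have h2 : (‖y‖ - ‖u‖) ^ 2 ≤ ‖y - u‖ ^ 2 := by
    rw [← sq_abs (‖y‖ - ‖u‖)]
    exact pow_le_pow_left₀ (abs_nonneg _) (abs_norm_sub_norm_le y u) 2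
  have h3 : ‖y‖ ^ 2 / 2 - ‖u‖ ^ 2 ≤ ‖y - u‖ ^ 2 := by
    nlinarith [sq_nonneg (‖y‖ - 2 * ‖u‖)]
  have h4 : M * ‖y‖ ≤ a / 4 * ‖y‖ ^ 2 + M ^ 2 / a := by
    have : a / 4 * ‖y‖ ^ 2 + M ^ 2 / a - M * ‖y‖ = (a / 2 * ‖y‖ - M) ^ 2 / a := by
      field_simp
      ring
    have h5 : 0 ≤ (a / 2 * ‖y‖ - M) ^ 2 / a := by positivity
    linarith
  have h5 := mul_le_mul_of_nonneg_left h3 ha0.le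
  unfold oraclePotential
  rw [← ha]
  linarith

theorem oracleZ_eq (g : 𝔼 → ℝ) (η : ℝ) (u : 𝔼) :
    oracleZ g η u = ∫ y, Real.exp (-oraclePotential g η u y) := by
  unfold oracleZ oraclePotential
  congr 1
  ext y
  ring_nf

theorem integrable_exp_neg_oraclePotential (hη : 0 < η)
    (hglip : ∀ x y, |g x - g y| ≤ M * ‖x - y‖) (u : 𝔼) :
    Integrable fun y => Real.exp (-oraclePotential g η u y) :=
  (quadraticallyCoercive_oraclePotential hη hglip u).integrable_exp_neg
    (continuous_oraclePotential hglip u)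

theorem oracleZ_pos (hη : 0 < η) (hglip : ∀ x y, |g x - g y| ≤ M * ‖x - y‖) (u : 𝔼) :
    0 < oracleZ g η u := by
  rw [oracleZ_eq]
  exact integral_exp_pos (integrable_exp_neg_oraclePotential hη hglip u)

/-- Translating the integration variable by `u - v` aligns the Gaussians and changes `g` by at most
`M ‖u - v‖`. -/
theorem log_oracleZ_sub_le (hη : 0 < η) (hglip : ∀ x y, |g x - g y| ≤ M * ‖x - y‖) (u v : 𝔼) :
    Real.log (oracleZ g η u) - Real.log (oracleZ g η v) ≤ M * ‖u - v‖ := by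
  have hu := oracleZ_pos hη hglip u
  have hv := oracleZ_pos hη hglip v
  have iu := integrable_exp_neg_oraclePotential hη hglip u
  have iv := integrable_exp_neg_oraclePotential hη hglip v
  have h : oracleZ g η u ≤ Real.exp (M * ‖u - v‖) * oracleZ g η v := by
    rw [oracleZ_eq, oracleZ_eq, ← integral_const_mul,
      ← integral_add_right_eq_self (fun y => Real.exp (-oraclePotential g η u y)) (u - v)]
    refine integral_mono (iu.comp_add_right _) (iv.const_mul _) fun y => ?_
    simp only [oraclePotential]
    rw [← Real.exp_add, show y + (u - v) - u = y - v by abel]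
    refine Real.exp_le_exp.2 ?_
    have h1 := (abs_le.1 (hglip (y + (u - v)) y)).1
    rw [add_sub_cancel_left] at h1
    linarith
  have h2 := Real.log_le_log hu h
  rw [Real.log_mul (Real.exp_pos _).ne' hv.ne', Real.log_exp] at h2
  linarith

theorem abs_log_oracleZ_sub_le (hη : 0 < η) (hglip : ∀ x y, |g x - g y| ≤ M * ‖x - y‖)
    (u v : 𝔼) : |Real.log (oracleZ g η u) - Real.log (oracleZ g η v)| ≤ M * ‖u - v‖ := by
  have h1 := log_oracleZ_sub_le hη hglip u v
  have h2 := log_oracleZ_sub_le hη hglip v u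
  rw [norm_sub_rev] at h2
  exact abs_le.2 ⟨by linarith, h1⟩

end Oracle

/-! ### Regularity of the Metropolis–Hastings log-ratio. -/

section Ratio

variable {f g : EuclideanSpace ℝ (Fin d) → ℝ} {L M η : ℝ}

theorem norm_gradStep_sub_le (hη : 0 < η) (hηL : η * L ≤ 1 / 16)
    (hsmooth : ∀ x y, ‖gradient f x - gradient f y‖ ≤ L * ‖x - y‖) (x y : 𝔼) :
    ‖gradStep f η x - gradStep f η y‖ ≤ 17 / 16 * ‖x - y‖ := by
  calc ‖gradStep f η x - gradStep f η y‖
      = ‖(x - y) - η • (gradient f x - gradient f y)‖ := by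
        unfold gradStep
        congr 1
        module
    _ ≤ ‖x - y‖ + η * (L * ‖x - y‖) := by
        refine (norm_sub_le _ _).trans ?_
        rw [norm_smul, Real.norm_of_nonneg hη.le]
        gcongr
        exact hsmooth x y
    _ ≤ 17 / 16 * ‖x - y‖ := by nlinarith [norm_nonneg (x - y)]

theorem logRatio_antisymm (x y : 𝔼) : logRatio f g η y x = -logRatio f g η x y := by
  unfold logRatio
  rw [← neg_sub x y, inner_neg_left, add_comm (gradient f y)]
  ring

theorem logRatio_self (x : 𝔼) : logRatio f g η x x = 0 := by
  simp [logRatio]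

/-- The log-ratio is almost additive along `b, y, z`: the difference equals `logRatio f g η y z`
plus a defect `P` built from gradient differences. The former splits into the trapezoid error `T`,
the gradient norms `Q` and the log-normalisers `R`. -/
theorem abs_logRatio_sub_le (hM : 0 ≤ M) (hη : 0 < η) (hηL : η * L ≤ 1 / 16)
    (hf : Differentiable ℝ f)
    (hsmooth : ∀ x y, ‖gradient f x - gradient f y‖ ≤ L * ‖x - y‖)
    (hglip : ∀ x y, |g x - g y| ≤ M * ‖x - y‖) (b y z : 𝔼) :
    |logRatio f g η b z - logRatio f g η b y| ≤
      L / 2 * ‖z - y‖ ^ 2 + L * ‖z - y‖ * ‖y - b‖ +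
        1 / 64 * ‖z - y‖ * (‖gradient f z‖ + ‖gradient f y‖) + 17 / 16 * M * ‖z - y‖ := by
  set T := f y - f z - (1 / 2) * inner ℝ (y - z) (gradient f z + gradient f y) with hT
  set P := (1 / 2) * (inner ℝ (z - y) (gradient f b - gradient f y) +
    inner ℝ (y - b) (gradient f z - gradient f y)) with hP
  set Q := η / 4 * (‖gradient f z‖ ^ 2 - ‖gradient f y‖ ^ 2) with hQ
  set R := Real.log (oracleZ g η (gradStep f η y)) - Real.log (oracleZ g η (gradStep f η z)) with hR
  have hdecomp : logRatio f g η b z - logRatio f g η b y = T + P - Q + R := by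
    simp only [logRatio, hT, hP, hQ, hR, inner_add_right, inner_sub_left, inner_sub_right]
    ring
  have bT : |T| ≤ L / 2 * ‖z - y‖ ^ 2 := by
    rw [norm_sub_rev z y]
    exact abs_sub_sub_inner_trapezoid_le hf hsmooth z y
  have bP : |P| ≤ L * ‖z - y‖ * ‖y - b‖ := by
    have h1 := (abs_real_inner_le_norm (z - y) (gradient f b - gradient f y)).trans
      (mul_le_mul_of_nonneg_left (hsmooth b y) (norm_nonneg _))
    have h2 := (abs_real_inner_le_norm (y - b) (gradient f z - gradient f y)).trans
      (mul_le_mul_of_nonneg_left (hsmooth z y) (norm_nonneg _))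
    rw [norm_sub_rev b y] at h1
    rw [hP, abs_mul, abs_of_pos (by norm_num : (0 : ℝ) < 1 / 2)]
    have := abs_add_le (inner ℝ (z - y) (gradient f b - gradient f y))
      (inner ℝ (y - b) (gradient f z - gradient f y))
    nlinarith
  have bQ : |Q| ≤ 1 / 64 * ‖z - y‖ * (‖gradient f z‖ + ‖gradient f y‖) := by
    have h1 := abs_norm_sq_sub_norm_sq_le (gradient f z) (gradient f y)
    rw [hQ, abs_mul, abs_of_pos (by positivity)]
    calc η / 4 * |‖gradient f z‖ ^ 2 - ‖gradient f y‖ ^ 2|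
        ≤ η / 4 * (L * ‖z - y‖ * (‖gradient f z‖ + ‖gradient f y‖)) := by
          gcongr
          refine h1.trans ?_
          gcongr
          exact hsmooth z y
      _ = η * L * (1 / 4 * ‖z - y‖ * (‖gradient f z‖ + ‖gradient f y‖)) := by ring
      _ ≤ 1 / 16 * (1 / 4 * ‖z - y‖ * (‖gradient f z‖ + ‖gradient f y‖)) := by gcongr
      _ = _ := by ring
  have bR : |R| ≤ 17 / 16 * M * ‖z - y‖ := by
    have h1 := abs_log_oracleZ_sub_le hη hglip (gradStep f η y) (gradStep f η z)
    have h2 := norm_gradStep_sub_le hη hηL hsmooth y z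
    rw [norm_sub_rev y z] at h2
    have := mul_le_mul_of_nonneg_left h2 hM
    linarith
  rw [hdecomp]
  have t1 := abs_add_le (T + P - Q) R
  have t2 := abs_sub (T + P) Q
  have t3 := abs_add_le T P
  linarith

/-- Moves the gradients to the base point `b`, so that the bound involves `y` and `z` only through
distances. -/
theorem abs_logRatio_sub_le' (hM : 0 ≤ M) (hη : 0 < η) (hηL : η * L ≤ 1 / 16)
    (hf : Differentiable ℝ f)
    (hsmooth : ∀ x y, ‖gradient f x - gradient f y‖ ≤ L * ‖x - y‖)
    (hglip : ∀ x y, |g x - g y| ≤ M * ‖x - y‖) (b y z : 𝔼) :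
    |logRatio f g η b z - logRatio f g η b y| ≤
      33 / 64 * L * ‖z - y‖ ^ 2 + 33 / 32 * L * ‖z - y‖ * ‖y - b‖ +
        1 / 32 * ‖z - y‖ * ‖gradient f b‖ + 17 / 16 * M * ‖z - y‖ := by
  have h := abs_logRatio_sub_le hM hη hηL hf hsmooth hglip b y z
  have h1 : ‖gradient f y‖ ≤ ‖gradient f b‖ + L * ‖y - b‖ := by
    have := norm_sub_norm_le (gradient f y) (gradient f b)
    linarith [hsmooth y b]
  have h2 : ‖gradient f z‖ ≤ ‖gradient f y‖ + L * ‖z - y‖ := by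
    have := norm_sub_norm_le (gradient f z) (gradient f y)
    linarith [hsmooth z y]
  have h3 : 1 / 64 * ‖z - y‖ * (‖gradient f z‖ + ‖gradient f y‖) ≤
      1 / 64 * ‖z - y‖ * (2 * ‖gradient f b‖ + 2 * (L * ‖y - b‖) + L * ‖z - y‖) :=
    mul_le_mul_of_nonneg_left (by linarith) (by positivity)
  linarith

theorem abs_logRatio_sub_le_left (hM : 0 ≤ M) (hη : 0 < η) (hηL : η * L ≤ 1 / 16)
    (hf : Differentiable ℝ f)
    (hsmooth : ∀ x y, ‖gradient f x - gradient f y‖ ≤ L * ‖x - y‖)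
    (hglip : ∀ x y, |g x - g y| ≤ M * ‖x - y‖) (x₁ x₂ y : 𝔼) :
    |logRatio f g η x₂ y - logRatio f g η x₁ y| ≤
      L / 2 * ‖x₁ - x₂‖ ^ 2 + L * ‖x₁ - x₂‖ * ‖y - x₁‖ +
        1 / 64 * ‖x₁ - x₂‖ * (‖gradient f x₁‖ + ‖gradient f x₂‖) +
          17 / 16 * M * ‖x₁ - x₂‖ := by
  have h := abs_logRatio_sub_le hM hη hηL hf hsmooth hglip y x₁ x₂
  rw [logRatio_antisymm x₂ y, logRatio_antisymm x₁ y, norm_sub_rev x₂ x₁, norm_sub_rev x₁ y] at h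
  rw [← abs_neg]
  convert! h using 2
  · ring
  · ring

theorem continuous_logRatio (hη : 0 < η) (hf : Differentiable ℝ f)
    (hsmooth : ∀ x y, ‖gradient f x - gradient f y‖ ≤ L * ‖x - y‖)
    (hglip : ∀ x y, |g x - g y| ≤ M * ‖x - y‖) (x : 𝔼) : Continuous (logRatio f g η x) := by
  have hfc := hf.continuous
  have hgrad : Continuous (gradient f) := by
    refine (LipschitzWith.of_dist_le' (K := |L|) fun x y => ?_).continuous
    rw [dist_eq_norm, dist_eq_norm]
    exact (hsmooth x y).trans (mul_le_mul_of_nonneg_right (le_abs_self L) (norm_nonneg _))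
  have hstep : Continuous (gradStep f η) := by
    unfold gradStep
    fun_prop
  have hlog : Continuous fun u => Real.log (oracleZ g η u) :=
    continuous_of_abs_sub_le (abs_log_oracleZ_sub_le hη hglip)
  have hlog' := hlog.comp hstep
  unfold logRatio
  simp only [Function.comp_def] at hlog'
  fun_prop

end Ratio

end ConditionedKernel

/-! ### The conditioned kernel as a Gibbs measure, and its entropy bounds. -/

noncomputable section ConditionedKernelBounds

variable {d : ℕ} {f g : EuclideanSpace ℝ (Fin d) → ℝ} {L M η : ℝ}

local notation "𝔼" => EuclideanSpace ℝ (Fin d)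

theorem proposalDensity_eq (f g : 𝔼 → ℝ) (η : ℝ) (x y : 𝔼) :
    proposalDensity f g η x y =
      (oracleZ g η (gradStep f η x))⁻¹ * Real.exp (-oraclePotential g η (gradStep f η x) y) := by
  unfold proposalDensity oraclePotential gradStep
  ring_nf

/-- The values of `g` in the target and in the proposals cancel, as do the terms `‖x - y‖² / (4η)`
once the squares are expanded. -/
theorem acceptProb_eq (hη : 0 < η) (hglip : ∀ x y, |g x - g y| ≤ M * ‖x - y‖) (x y : 𝔼) :
    acceptProb f g η x y = min 1 (Real.exp (logRatio f g η x y)) := by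
  have hx := oracleZ_pos hη hglip (gradStep f η x)
  have hy := oracleZ_pos hη hglip (gradStep f η y)
  unfold acceptProb
  congr 1
  rw [proposalDensity_eq, proposalDensity_eq]
  have e0 : oracleZ g η (gradStep f η y) = Real.exp (Real.log (oracleZ g η (gradStep f η y))) :=
    (Real.exp_log hy).symm
  have e0' : oracleZ g η (gradStep f η x) = Real.exp (Real.log (oracleZ g η (gradStep f η x))) :=
    (Real.exp_log hx).symm
  rw [congrArg Inv.inv e0, congrArg Inv.inv e0', ← Real.exp_neg, ← Real.exp_neg, ← Real.exp_add, ← Real.exp_add, ← Real.exp_add,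
    ← Real.exp_add, ← Real.exp_sub]
  congr 1
  have e1 : ‖x - gradStep f η y‖ ^ 2 = ‖x - y‖ ^ 2 + 2 * (η * inner ℝ (x - y) (gradient f y)) +
      η ^ 2 * ‖gradient f y‖ ^ 2 := by
    rw [show x - gradStep f η y = (x - y) + η • gradient f y by unfold gradStep; abel,
      norm_add_sq_real, real_inner_smul_right, norm_smul, mul_pow, Real.norm_eq_abs, sq_abs]
  have e2 : ‖y - gradStep f η x‖ ^ 2 = ‖x - y‖ ^ 2 - 2 * (η * inner ℝ (x - y) (gradient f x)) +
      η ^ 2 * ‖gradient f x‖ ^ 2 := by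
    rw [show y - gradStep f η x = -((x - y) - η • gradient f x) by unfold gradStep; abel,
      norm_neg, norm_sub_sq_real, real_inner_smul_right, norm_smul, mul_pow, Real.norm_eq_abs,
      sq_abs]
  unfold oraclePotential logRatio
  rw [e1, e2, inner_add_right]
  field_simp
  ring

theorem proposalDensity_mul_acceptProb (hη : 0 < η)
    (hglip : ∀ x y, |g x - g y| ≤ M * ‖x - y‖) (x y : 𝔼) :
    proposalDensity f g η x y * acceptProb f g η x y =
      (oracleZ g η (gradStep f η x))⁻¹ * Real.exp (-succPotential f g η x y) := by
  rw [acceptProb_eq hη hglip, proposalDensity_eq, mul_assoc]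
  congr 1
  rw [← Real.exp_zero, ← Real.exp_strictMono.monotone.map_min, ← Real.exp_add]
  congr 1
  unfold oraclePotential succPotential
  have : max 0 (-logRatio f g η x y) = -min 0 (logRatio f g η x y) := by
    rw [← neg_zero, max_neg_neg, neg_zero]
  rw [this]
  ring

theorem continuous_succPotential (hη : 0 < η) (hf : Differentiable ℝ f)
    (hsmooth : ∀ x y, ‖gradient f x - gradient f y‖ ≤ L * ‖x - y‖)
    (hglip : ∀ x y, |g x - g y| ≤ M * ‖x - y‖) (x : 𝔼) : Continuous (succPotential f g η x) :=
  (continuous_oraclePotential hglip (gradStep f η x)).add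
    (continuous_const.max (continuous_logRatio hη hf hsmooth hglip x).neg)

theorem quadraticallyCoercive_succPotential (hη : 0 < η)
    (hglip : ∀ x y, |g x - g y| ≤ M * ‖x - y‖) (x : 𝔼) :
    QuadraticallyCoercive (succPotential f g η x) := by
  obtain ⟨a, c, ha, h⟩ := quadraticallyCoercive_oraclePotential hη hglip (gradStep f η x)
  exact ⟨a, c, ha, fun y => (h y).trans (le_add_of_nonneg_right (le_max_left _ _))⟩

theorem quadraticallyBounded_succPotential (hM : 0 ≤ M) (hη : 0 < η)
    (hηL : η * L ≤ 1 / 16) (hf : Differentiable ℝ f)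
    (hsmooth : ∀ x y, ‖gradient f x - gradient f y‖ ≤ L * ‖x - y‖)
    (hglip : ∀ x y, |g x - g y| ≤ M * ‖x - y‖) (x : 𝔼) :
    QuadraticallyBounded (succPotential f g η x) := by
  have hg : QuadraticallyBounded g := by
    refine .exists_poly (a := |g 0|) (b := M) (c := 0) (x := 0) fun y => ?_
    have := abs_sub_abs_le_abs_sub (g y) (g 0)
    linarith [hglip y 0]
  have hH : QuadraticallyBounded (logRatio f g η x) := by
    refine .exists_poly (a := 0) (b := 1 / 32 * ‖gradient f x‖ + 17 / 16 * M) (c := 33 / 64 * L)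
      (x := x) fun y => ?_
    have h := abs_logRatio_sub_le' hM hη hηL hf hsmooth hglip x x y
    rw [logRatio_self, sub_zero, sub_self, norm_zero] at h
    linarith
  refine (((QuadraticallyBounded.norm_sub_sq _).const_mul _).add hg).add (hH.mono fun y => ?_)
  rw [abs_of_nonneg (le_max_left _ _)]
  exact max_le (abs_nonneg _) (neg_le_abs _)

theorem abs_max_zero_neg_sub_le (a b : ℝ) : |max 0 (-a) - max 0 (-b)| ≤ |a - b| := by
  have h := abs_max_sub_max_le_abs (-a) (-b) 0
  rwa [max_comm _ 0, max_comm _ 0, neg_sub_neg, abs_sub_comm b a] at h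

/-- Under the conditioned kernel at `x` the mean distance to `x` is of order
`√(η d) + η (‖∇f(x)‖ + M)`. -/
theorem integral_norm_sub_mul_exp_neg_succPotential_le (hM : 0 < M) (hη : 0 < η)
    (hηL : η * L ≤ 1 / 16) (hf : Differentiable ℝ f)
    (hsmooth : ∀ x y, ‖gradient f x - gradient f y‖ ≤ L * ‖x - y‖)
    (hglip : ∀ x y, |g x - g y| ≤ M * ‖x - y‖) (x : 𝔼) :
    ∫ y, ‖y - x‖ * Real.exp (-succPotential f g η x y) ≤
      (5 / 2 * √(η * d) + 8 * η * (‖gradient f x‖ / 3 + 5 / 4 * M)) *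
        ∫ y, Real.exp (-succPotential f g η x y) := by
  set W := succPotential f g η x with hWdef
  set G := ‖gradient f x‖ with hG
  have hG0 : 0 ≤ G := norm_nonneg _
  -- Chosen so that halving the distance `r` to `x` lowers `W` by at least `r² / (8η) - β r`.
  set β := G / 3 + 5 / 4 * M with hβ
  have hβ0 : 0 < β := by positivity
  set K := 5 / 2 * √(η * d) + 8 * η * β with hK
  have hWc : Continuous W := continuous_succPotential hη hf hsmooth hglip x
  have hWq : QuadraticallyCoercive W := quadraticallyCoercive_succPotential hη hglip x
  have iW := hWq.integrable_exp_neg hWc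
  have ir : Integrable fun y => ‖y - x‖ * Real.exp (-W y) :=
    (QuadraticallyBounded.norm_sub x).integrable_mul_exp_neg (by fun_prop) hWq hWc
  have hI : 0 < ∫ y, Real.exp (-W y) := integral_exp_pos iW
  have hiB : ∀ y, ((K / (4 * η) - β) * ‖y - x‖ - K ^ 2 / (8 * η)) * Real.exp (-W y) =
      (K / (4 * η) - β) * (‖y - x‖ * Real.exp (-W y)) - K ^ 2 / (8 * η) * Real.exp (-W y) :=
    fun y => by ring
  have iB : Integrable fun y =>
      ((K / (4 * η) - β) * ‖y - x‖ - K ^ 2 / (8 * η)) * Real.exp (-W y) := by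
    simp only [hiB]
    exact (ir.const_mul _).sub (iW.const_mul _)
  have hLη : L ≤ 1 / (16 * η) := by
    rw [le_div_iff₀ (by positivity)]
    linarith
  have key := integral_mul_exp_neg_le_of_contraction x iW iB fun y => by
    set r := ‖y - x‖ with hr
    have hr0 : 0 ≤ r := norm_nonneg _
    set z := x + (2⁻¹ : ℝ) • (y - x) with hz
    have hyz : ‖y - z‖ = r / 2 := by
      rw [show y - z = (2⁻¹ : ℝ) • (y - x) by rw [hz]; module, norm_smul,
        Real.norm_of_nonneg (by norm_num)]
      ring
    have hzx : ‖z - x‖ = r / 2 := by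
      rw [hz, add_sub_cancel_left, norm_smul, Real.norm_of_nonneg (by norm_num)]
      ring
    have h1 : 1 / (4 * η) * ‖y - gradStep f η x‖ ^ 2 - 1 / (4 * η) * ‖z - gradStep f η x‖ ^ 2 ≥
        3 / (16 * η) * r ^ 2 - r * G / 4 := by
      have e1 : y - gradStep f η x = (y - x) + η • gradient f x := by unfold gradStep; abel
      have e2 : z - gradStep f η x = (2⁻¹ : ℝ) • (y - x) + η • gradient f x := by
        rw [hz]; unfold gradStep; abel
      have e3 := (abs_le.1 (abs_real_inner_le_norm (y - x) (gradient f x))).1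
      rw [← hr, ← hG] at e3
      rw [e1, e2, norm_add_sq_real, norm_add_sq_real, real_inner_smul_right,
        real_inner_smul_right, real_inner_smul_left, norm_smul (2⁻¹ : ℝ),
        Real.norm_of_nonneg (by norm_num : (0 : ℝ) ≤ 2⁻¹), ← hr]
      have e4 : 1 / (4 * η) * (r ^ 2 + 2 * (η * inner ℝ (y - x) (gradient f x)) +
          ‖η • gradient f x‖ ^ 2) - 1 / (4 * η) * ((2⁻¹ * r) ^ 2 +
          2 * (η * (2⁻¹ * inner ℝ (y - x) (gradient f x))) + ‖η • gradient f x‖ ^ 2) =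
          3 / (16 * η) * r ^ 2 + inner ℝ (y - x) (gradient f x) / 4 := by
        field_simp
        ring
      rw [e4]
      linarith
    have h2 := (abs_le.1 (hglip y z)).1
    rw [hyz] at h2
    have h3 := abs_logRatio_sub_le' hM.le hη hηL hf hsmooth hglip x z y
    rw [hyz, hzx, ← hG] at h3
    have h4 := (abs_le.1 ((abs_max_zero_neg_sub_le (logRatio f g η x y)
      (logRatio f g η x z)).trans h3)).1
    have h5 : L * r ^ 2 ≤ 1 / (16 * η) * r ^ 2 := by gcongr
    -- Tangent line to `r²` at `r = K`: it makes the lower bound affine in `r`, so that its mean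
    -- yields a bound on the mean of `r`.
    have h6 : (K / (4 * η) - β) * r - K ^ 2 / (8 * η) ≤ 1 / (8 * η) * r ^ 2 - β * r := by
      have : 1 / (8 * η) * r ^ 2 - β * r - ((K / (4 * η) - β) * r - K ^ 2 / (8 * η)) =
          (r - K) ^ 2 / (8 * η) := by
        field_simp
        ring
      have h7 : 0 ≤ (r - K) ^ 2 / (8 * η) := by positivity
      linarith
    have h8 : 3 / (16 * η) * r ^ 2 = 3 * (1 / (16 * η) * r ^ 2) := by ring
    have h9 : 1 / (8 * η) * r ^ 2 = 2 * (1 / (16 * η) * r ^ 2) := by ring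
    have h10 : 0 ≤ 1 / (16 * η) * r ^ 2 := by positivity
    have h11 := mul_nonneg hM.le hr0
    have h12 := mul_nonneg hG0 hr0
    refine h6.trans ?_
    rw [h9, hβ, hWdef]
    unfold succPotential
    nlinarith
  rw [integral_congr_ae (Filter.Eventually.of_forall hiB),
    integral_sub (ir.const_mul _) (iW.const_mul _), integral_const_mul, integral_const_mul,
    finrank_euclideanSpace_fin] at key
  have hs0 := Real.sqrt_nonneg (η * d)
  have hsq : √(η * d) ^ 2 = η * d := Real.sq_sqrt (by positivity)
  -- Here `K - 8ηβ = 5/2 √(ηd)`; the constant `5/2` works because `8 log 2 < 25/4`.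
  have hd : d * Real.log 2 ≤ K * (K - 8 * η * β) / (8 * η) := by
    rw [le_div_iff₀ (by positivity)]
    have h1 := Real.log_two_lt_d9
    have h2 : d * Real.log 2 * (8 * η) ≤ 25 / 4 * (η * d) := by
      have : 0 ≤ η * d := by positivity
      nlinarith
    have h3 : 0 ≤ 8 * η * β * √(η * d) := by positivity
    rw [hK]
    nlinarith
  have hcoef : 0 < K / (4 * η) - β := by
    have : K / (4 * η) - β = 5 / 8 * √(η * d) / η + β := by
      rw [hK]
      field_simp
      ring
    rw [this]
    positivity
  have h1 : (d * Real.log 2 + K ^ 2 / (8 * η)) * ∫ y, Real.exp (-W y) ≤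
      (K * (K / (4 * η) - β)) * ∫ y, Real.exp (-W y) := by
    refine mul_le_mul_of_nonneg_right ?_ hI.le
    have : K * (K / (4 * η) - β) = K * (K - 8 * η * β) / (8 * η) + K ^ 2 / (8 * η) := by
      field_simp
      ring
    linarith
  refine le_of_mul_le_mul_left ?_ hcoef
  linarith

/-- Shifting by the displacement of the gradient step cancels the linear part of the difference of
the potentials at `x₁` and `x₂`. -/
theorem succPotential_increment_le (hL : 0 ≤ L) (hM : 0 < M) (hη : 0 < η)
    (hηL : η * L ≤ 1 / 16) (hf : Differentiable ℝ f)
    (hsmooth : ∀ x y, ‖gradient f x - gradient f y‖ ≤ L * ‖x - y‖)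
    (hglip : ∀ x y, |g x - g y| ≤ M * ‖x - y‖) (x₁ x₂ y : 𝔼) :
    succPotential f g η x₁ (y + (gradStep f η x₂ - gradStep f η x₁)) - succPotential f g η x₁ y +
        (succPotential f g η x₂ y - succPotential f g η x₁ y) ≤
      ‖x₁ - x₂‖ ^ 2 / η + ‖x₁ - x₂‖ * (4 * M + ‖gradient f x₁‖ + ‖gradient f x₂‖) +
        9 / 4 * L * ‖x₁ - x₂‖ * ‖y - x₁‖ := by
  set w := gradStep f η x₂ - gradStep f η x₁ with hw
  set G₁ := ‖gradient f x₁‖ with hG₁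
  set G₂ := ‖gradient f x₂‖ with hG₂
  set Δ := ‖x₁ - x₂‖ with hΔ
  have hG₁0 : 0 ≤ G₁ := norm_nonneg _
  have hG₂0 : 0 ≤ G₂ := norm_nonneg _
  have hΔ0 : 0 ≤ Δ := norm_nonneg _
  have hLη : L ≤ 1 / (16 * η) := by
    rw [le_div_iff₀ (by positivity)]
    linarith
  set r := ‖y - x₁‖ with hr
  have hr0 : 0 ≤ r := norm_nonneg _
  have hω0 : 0 ≤ ‖w‖ := norm_nonneg _
  have hω : ‖w‖ ≤ 17 / 16 * Δ := by
    rw [hw, hΔ, norm_sub_rev x₁ x₂]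
    exact norm_gradStep_sub_le hη hηL hsmooth x₂ x₁
  -- Parallelogram identity around `y - gradStep f η x₁`; this is what dictates the choice of `w`.
  have h1 : ‖y + w - gradStep f η x₁‖ ^ 2 + ‖y - gradStep f η x₂‖ ^ 2 -
      2 * ‖y - gradStep f η x₁‖ ^ 2 = 2 * ‖w‖ ^ 2 := by
    rw [show y + w - gradStep f η x₁ = (y - gradStep f η x₁) + w by abel,
      show y - gradStep f η x₂ = (y - gradStep f η x₁) - w by rw [hw]; abel,
      norm_add_sq_real, norm_sub_sq_real (y - gradStep f η x₁) w]
    ring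
  have h2 := (abs_le.1 (hglip (y + w) y)).2
  rw [add_sub_cancel_left] at h2
  have h3 := abs_logRatio_sub_le' hM.le hη hηL hf hsmooth hglip x₁ y (y + w)
  rw [add_sub_cancel_left] at h3
  have h4 := (abs_le.1 ((abs_max_zero_neg_sub_le (logRatio f g η x₁ (y + w))
    (logRatio f g η x₁ y)).trans h3)).2
  have h5 := abs_logRatio_sub_le_left hM.le hη hηL hf hsmooth hglip x₁ x₂ y
  have h6 := (abs_le.1 ((abs_max_zero_neg_sub_le (logRatio f g η x₂ y)
    (logRatio f g η x₁ y)).trans h5)).2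
  rw [← hr, ← hG₁] at h4
  rw [← hr, ← hG₁, ← hG₂, ← hΔ] at h6
  have hω2 : ‖w‖ ^ 2 ≤ 289 / 256 * Δ ^ 2 := by nlinarith
  have b1 : 1 / (2 * η) * ‖w‖ ^ 2 ≤ 289 / 512 * (Δ ^ 2 / η) := by
    calc 1 / (2 * η) * ‖w‖ ^ 2 ≤ 1 / (2 * η) * (289 / 256 * Δ ^ 2) := by gcongr
      _ = _ := by ring
  have b2 : L * ‖w‖ ^ 2 ≤ 289 / 256 * (L * Δ ^ 2) := by
    have := mul_le_mul_of_nonneg_left hω2 hL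
    linarith
  have b3 : L * Δ ^ 2 ≤ 1 / 16 * (Δ ^ 2 / η) := by
    calc L * Δ ^ 2 ≤ 1 / (16 * η) * Δ ^ 2 := by gcongr
      _ = _ := by ring
  have b4 : M * ‖w‖ ≤ 17 / 16 * (M * Δ) := by
    have := mul_le_mul_of_nonneg_left hω hM.le
    linarith
  have b5 : L * ‖w‖ * r ≤ 17 / 16 * (L * Δ * r) := by
    have := mul_le_mul_of_nonneg_left hω (mul_nonneg hL hr0)
    linarith
  have b6 : ‖w‖ * G₁ ≤ 17 / 16 * (Δ * G₁) := by
    have := mul_le_mul_of_nonneg_right hω hG₁0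
    linarith
  have b7 : 0 ≤ Δ ^ 2 / η := by positivity
  have b8 : 0 ≤ M * Δ := by positivity
  have b9 : 0 ≤ Δ * G₁ := by positivity
  have b10 : 0 ≤ Δ * G₂ := by positivity
  have b11 : 0 ≤ L * Δ * r := by positivity
  have h7 : 1 / (4 * η) * ‖y + w - gradStep f η x₁‖ ^ 2 +
      1 / (4 * η) * ‖y - gradStep f η x₂‖ ^ 2 - 2 * (1 / (4 * η) * ‖y - gradStep f η x₁‖ ^ 2) =
      1 / (2 * η) * ‖w‖ ^ 2 := by
    linear_combination 1 / (4 * η) * h1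
  unfold succPotential
  linarith

/-- One-sided relative entropy bound between the conditioned kernels at `x₁` and `x₂`. -/
theorem integral_succPotential_sub_le (hL : 0 ≤ L) (hM : 0 < M) (hη : 0 < η)
    (hηL : η * L ≤ 1 / 16) (hf : Differentiable ℝ f)
    (hsmooth : ∀ x y, ‖gradient f x - gradient f y‖ ≤ L * ‖x - y‖)
    (hglip : ∀ x y, |g x - g y| ≤ M * ‖x - y‖) (x₁ x₂ : 𝔼) :
    ∫ y, (succPotential f g η x₂ y - succPotential f g η x₁ y) *
        Real.exp (-succPotential f g η x₁ y) ≤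
      (‖x₁ - x₂‖ ^ 2 / η + 10 * (‖x₁ - x₂‖ *
        (‖gradient f x₁‖ + ‖gradient f x₂‖ + M + L * √(η * d)))) *
        ∫ y, Real.exp (-succPotential f g η x₁ y) := by
  set W₁ := succPotential f g η x₁ with hW₁
  set W₂ := succPotential f g η x₂ with hW₂
  set G₁ := ‖gradient f x₁‖ with hG₁
  set G₂ := ‖gradient f x₂‖ with hG₂
  set Δ := ‖x₁ - x₂‖ with hΔ
  have hG₁0 : 0 ≤ G₁ := norm_nonneg _
  have hG₂0 : 0 ≤ G₂ := norm_nonneg _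
  have hΔ0 : 0 ≤ Δ := norm_nonneg _
  have hWc : ∀ x, Continuous (succPotential f g η x) :=
    continuous_succPotential hη hf hsmooth hglip
  have hWq : QuadraticallyCoercive W₁ := quadraticallyCoercive_succPotential hη hglip x₁
  have hWb : ∀ x, QuadraticallyBounded (succPotential f g η x) :=
    quadraticallyBounded_succPotential hM.le hη hηL hf hsmooth hglip
  have iW := hWq.integrable_exp_neg (hWc x₁)
  have ir : Integrable fun y => ‖y - x₁‖ * Real.exp (-W₁ y) :=
    (QuadraticallyBounded.norm_sub x₁).integrable_mul_exp_neg (by fun_prop) hWq (hWc x₁)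
  have iD : Integrable fun y => (W₂ y - W₁ y) * Real.exp (-W₁ y) :=
    ((hWb x₂).sub (hWb x₁)).integrable_mul_exp_neg ((hWc x₂).sub (hWc x₁)) hWq (hWc x₁)
  have hI : 0 < ∫ y, Real.exp (-W₁ y) := integral_exp_pos iW
  set c₀ := Δ ^ 2 / η + Δ * (4 * M + G₁ + G₂) with hc₀
  set c₁ := 9 / 4 * L * Δ with hc₁
  have hR : ∀ y, (c₀ + c₁ * ‖y - x₁‖ - (W₂ y - W₁ y)) * Real.exp (-W₁ y) =
      c₀ * Real.exp (-W₁ y) + c₁ * (‖y - x₁‖ * Real.exp (-W₁ y)) -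
        (W₂ y - W₁ y) * Real.exp (-W₁ y) := fun y => by ring
  have iR₁ : Integrable fun y =>
      c₀ * Real.exp (-W₁ y) + c₁ * (‖y - x₁‖ * Real.exp (-W₁ y)) :=
    (iW.const_mul _).add (ir.const_mul _)
  have iR : Integrable fun y =>
      (c₀ + c₁ * ‖y - x₁‖ - (W₂ y - W₁ y)) * Real.exp (-W₁ y) := by
    simp only [hR]
    exact iR₁.sub iD
  -- The increment bound minus `W₂ - W₁` dominates `W₁(y + w) - W₁(y)`, so it has nonnegative mean
  -- under the density of `W₁`.
  have key := integral_mul_exp_neg_nonneg_of_shift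
    (gradStep f η x₂ - gradStep f η x₁) iW iR fun y =>
      le_sub_iff_add_le.2
        (succPotential_increment_le hL hM hη hηL hf hsmooth hglip x₁ x₂ y)
  rw [integral_congr_ae (Filter.Eventually.of_forall hR), integral_sub iR₁ iD,
    integral_add (iW.const_mul _) (ir.const_mul _), integral_const_mul, integral_const_mul] at key
  have hmean := integral_norm_sub_mul_exp_neg_succPotential_le hM hη hηL hf hsmooth hglip x₁
  rw [← hW₁, ← hG₁] at hmean
  have hc₁0 : 0 ≤ c₁ := by positivity
  have h1 := mul_le_mul_of_nonneg_left hmean hc₁0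
  have h2 : c₀ + c₁ * (5 / 2 * √(η * d) + 8 * η * (G₁ / 3 + 5 / 4 * M)) ≤
      Δ ^ 2 / η + 10 * (Δ * (G₁ + G₂ + M + L * √(η * d))) := by
    have e1 : Δ * (η * L) * (G₁ / 3 + 5 / 4 * M) ≤ Δ * (1 / 16) * (G₁ / 3 + 5 / 4 * M) := by
      gcongr
    have b8 : 0 ≤ Δ * M := by positivity
    have b9 : 0 ≤ Δ * G₁ := by positivity
    have b10 : 0 ≤ Δ * G₂ := by positivity
    have b11 : 0 ≤ Δ * (L * √(η * d)) := by positivity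
    rw [hc₀, hc₁]
    linarith
  have h3 := mul_le_mul_of_nonneg_right h2 hI.le
  linarith

/-! ### Identification of the measures in the statement. -/

theorem acceptedMeasure_apply (hη : 0 < η) (hf : Differentiable ℝ f)
    (hsmooth : ∀ x y, ‖gradient f x - gradient f y‖ ≤ L * ‖x - y‖)
    (hglip : ∀ x y, |g x - g y| ≤ M * ‖x - y‖) (x : 𝔼) {A : Set 𝔼} (hA : MeasurableSet A) :
    acceptedMeasure f g η x A = ENNReal.ofReal ((oracleZ g η (gradStep f η x))⁻¹ *
      ∫ y in A, Real.exp (-succPotential f g η x y)) := by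
  have iW := (quadraticallyCoercive_succPotential (f := f) hη hglip x).integrable_exp_neg
    (continuous_succPotential hη hf hsmooth hglip x)
  unfold acceptedMeasure
  rw [withDensity_apply _ hA, ← integral_const_mul,
    ofReal_integral_eq_lintegral_ofReal (iW.const_mul _).integrableOn
      (Filter.Eventually.of_forall fun y => mul_nonneg
        (inv_nonneg.2 (oracleZ_pos hη hglip _).le) (Real.exp_pos _).le)]
  simp only [proposalDensity_mul_acceptProb hη hglip]

theorem acceptedMeasure_univ_pos_and_lt_top (hη : 0 < η) (hf : Differentiable ℝ f)
    (hsmooth : ∀ x y, ‖gradient f x - gradient f y‖ ≤ L * ‖x - y‖)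
    (hglip : ∀ x y, |g x - g y| ≤ M * ‖x - y‖) (x : 𝔼) :
    0 < acceptedMeasure f g η x Set.univ ∧ acceptedMeasure f g η x Set.univ < ⊤ := by
  have iW := (quadraticallyCoercive_succPotential (f := f) hη hglip x).integrable_exp_neg
    (continuous_succPotential hη hf hsmooth hglip x)
  rw [acceptedMeasure_apply hη hf hsmooth hglip x MeasurableSet.univ, setIntegral_univ]
  exact ⟨ENNReal.ofReal_pos.2 (mul_pos (inv_pos.2 (oracleZ_pos hη hglip _)) (integral_exp_pos iW)),
    ENNReal.ofReal_lt_top⟩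

theorem isProbabilityMeasure_succKernel (hη : 0 < η) (hf : Differentiable ℝ f)
    (hsmooth : ∀ x y, ‖gradient f x - gradient f y‖ ≤ L * ‖x - y‖)
    (hglip : ∀ x y, |g x - g y| ≤ M * ‖x - y‖) (x : 𝔼) :
    IsProbabilityMeasure (succKernel f g η x) := by
  obtain ⟨h0, htop⟩ := acceptedMeasure_univ_pos_and_lt_top hη hf hsmooth hglip x
  refine ⟨?_⟩
  rw [succKernel, Measure.smul_apply, smul_eq_mul, ENNReal.inv_mul_cancel h0.ne' htop.ne]

theorem succKernel_real_apply (hη : 0 < η) (hf : Differentiable ℝ f)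
    (hsmooth : ∀ x y, ‖gradient f x - gradient f y‖ ≤ L * ‖x - y‖)
    (hglip : ∀ x y, |g x - g y| ≤ M * ‖x - y‖) (x : 𝔼) {A : Set 𝔼} (hA : MeasurableSet A) :
    (succKernel f g η x).real A = (∫ y, Real.exp (-succPotential f g η x y))⁻¹ *
      ∫ y in A, Real.exp (-succPotential f g η x y) := by
  have hZ := inv_pos.2 (oracleZ_pos hη hglip (gradStep f η x))
  have h0 : ∀ B : Set 𝔼, 0 ≤ ∫ y in B, Real.exp (-succPotential f g η x y) :=
    fun B => integral_nonneg fun y => (Real.exp_pos _).le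
  rw [succKernel, measureReal_def, Measure.smul_apply, smul_eq_mul, ENNReal.toReal_mul,
    ENNReal.toReal_inv, acceptedMeasure_apply hη hf hsmooth hglip x MeasurableSet.univ,
    acceptedMeasure_apply hη hf hsmooth hglip x hA,
    ENNReal.toReal_ofReal (mul_nonneg hZ.le (h0 _)),
    ENNReal.toReal_ofReal (mul_nonneg hZ.le (h0 _)), setIntegral_univ, mul_inv, mul_mul_mul_comm,
    inv_mul_cancel₀ hZ.ne', one_mul]

end ConditionedKernelBounds

/-! ### The total variation bound. -/

theorem lemma2 {d : ℕ} (f g : EuclideanSpace ℝ (Fin d) → ℝ) (L M η : ℝ)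
    (hL : 0 ≤ L)
    (hf : Differentiable ℝ f)
    (hsmooth : ∀ x y, ‖gradient f x - gradient f y‖ ≤ L * ‖x - y‖)
    (hdiss : ∃ (x₀ : EuclideanSpace ℝ (Fin d)) (μ β : ℝ), 0 < μ ∧ 0 < β ∧
      ∀ x, μ / 2 * ‖x - x₀‖ ^ 2 - β ≤ inner ℝ (gradient f x) (x - x₀))
    (hM : 0 < M)
    (hgconv : ConvexOn ℝ Set.univ g)
    (hglip : ∀ x y, |g x - g y| ≤ M * ‖x - y‖)
    (hη : 0 < η) (hη' : η < 1 / (16 * (L + 1)))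
    (x₁ x₂ : EuclideanSpace ℝ (Fin d)) :
    IsProbabilityMeasure (succKernel f g η x₁) ∧
    IsProbabilityMeasure (succKernel f g η x₂) ∧
    tvDist (succKernel f g η x₁) (succKernel f g η x₂) ≤
      5 * √(‖x₁ - x₂‖ *
        (‖gradient f x₁‖ + ‖gradient f x₂‖ + M + L * √(η * d))) +
      2 * (‖x₁ - x₂‖ / √η) := by
  refine ⟨isProbabilityMeasure_succKernel hη hf hsmooth hglip x₁,
    isProbabilityMeasure_succKernel hη hf hsmooth hglip x₂, ?_⟩
  have hηL : η * L ≤ 1 / 16 := by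
    rw [lt_div_iff₀ (by positivity)] at hη'
    linarith
  set S := ‖x₁ - x₂‖ * (‖gradient f x₁‖ + ‖gradient f x₂‖ + M + L * √(η * d)) with hS
  have hS0 : 0 ≤ S := by positivity
  have : Nonempty {A : Set (EuclideanSpace ℝ (Fin d)) // MeasurableSet A} :=
    ⟨⟨∅, MeasurableSet.empty⟩⟩
  refine ciSup_le fun A => ?_
  -- The entropy bound must be strictly positive below, so coinciding points are treated apart.
  rcases eq_or_ne x₁ x₂ with h | h
  · rw [h, sub_self, abs_zero]
    positivity
  have hΔ : 0 < ‖x₁ - x₂‖ := norm_sub_pos_iff.2 h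
  have hcont := continuous_succPotential hη hf hsmooth hglip
  have hcoer := quadraticallyCoercive_succPotential (f := f) hη hglip
  have hbdd := quadraticallyBounded_succPotential hM.le hη hηL hf hsmooth hglip
  have hK₁ := integral_succPotential_sub_le hL hM hη hηL hf hsmooth hglip x₁ x₂
  have hK₂ := integral_succPotential_sub_le hL hM hη hηL hf hsmooth hglip x₂ x₁
  -- The bound is symmetric in the two points, so one constant serves both directions.
  rw [norm_sub_rev x₂ x₁, add_comm ‖gradient f x₂‖] at hK₂
  rw [← hS] at hK₁ hK₂
  rw [succKernel_real_apply hη hf hsmooth hglip x₁ A.2,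
    succKernel_real_apply hη hf hsmooth hglip x₂ A.2]
  refine (abs_setIntegral_div_sub_le (by positivity) ((hcoer x₁).integrable_exp_neg (hcont x₁))
    ((hcoer x₂).integrable_exp_neg (hcont x₂))
    (((hbdd x₂).sub (hbdd x₁)).integrable_mul_exp_neg ((hcont x₂).sub (hcont x₁))
      (hcoer x₁) (hcont x₁))
    (((hbdd x₁).sub (hbdd x₂)).integrable_mul_exp_neg ((hcont x₁).sub (hcont x₂))
      (hcoer x₂) (hcont x₂)) hK₁ hK₂ A.2).trans ?_
  have hq : 0 ≤ ‖x₁ - x₂‖ / √η := by positivity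
  have hq2 : (‖x₁ - x₂‖ / √η) ^ 2 = ‖x₁ - x₂‖ ^ 2 / η := by rw [div_pow, Real.sq_sqrt hη.le]
  have hs2 := Real.sq_sqrt hS0
  have hs0 := Real.sqrt_nonneg S
  refine Real.sqrt_le_iff.2 ⟨by positivity, ?_⟩
  rw [← hq2]
  -- With `q = ‖x₁ - x₂‖ / √η`, the claim is `q² + 10 S ≤ (5 √S + 2 q)²`.
  nlinarith [mul_nonneg hs0 hq, sq_nonneg (‖x₁ - x₂‖ / √η)]
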